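/- Let $\mathbb H$ be the quaternions, $\mathbb S=\{J\in\mathbb H : J^2=-1\}$, and let $\mu$ be a Borel probability measure on $\mathbb S$ that is invariant under the involution $J\mapsto -J$. A stem function is a map $F=F_1+F_2\imath:\mathbb C\to\mathbb H\otimes_{\mathbb R}\mathbb C$ (with $F_1,F_2:\mathbb C\to\mathbb H$, $\imath=1\otimes i$, and $\overline{p+q\imath}=p-q\imath$ for $p,q\in\mathbb H$) such that $F(\bar z)=\overline{F(z)}$ for all $z\in\mathbb C$. It induces the function $\mathcal I(F):\mathbb H\to\mathbb H$ given by $\mathcal I(F)(\alpha+I\beta)=F_1(\alpha+i\beta)+I\,F_2(\alpha+i\beta)$ for $\alpha,\beta\in\mathbb R$, $I\in\mathbb S$. A function $\mathbb H\to\mathbb H$ is called (left) slice regular if it is induced by a holomorphic stem function, i.e. one of class $C^1$ with $\frac12\left(\frac{\partial F}{\partial\alpha}+\imath\frac{\partial F}{\partial\beta}\right)=0$ on $\mathbb C$, and (left) anti-regular if it is induced by an anti-holomorphic stem function, i.e. one of class $C^1$ with $\frac12\left(\frac{\partial F}{\partial\alpha}-\imath\frac{\partial F}{\partial\beta}\right)=0$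 on $\mathbb C$. Let $f:\mathbb H\to\mathbb H$ be a continuous function, and for $p=a+bI\in\mathbb H$ (with $a,b\in\mathbb R$, $I\in\mathbb S$) and $r>0$ put $$M_{p,r}=\frac{1}{2\pi}\int_{\mathbb S}\int_0^{2\pi}(1-IJ)\,f\left(a+bJ+re^{J\theta}\right)\,d\theta\,d\mu(J).$$ (By the invariance of $\mu$ this does not depend on the choice of the representation $p=a+bI$.) Then $f$ is the sum of a slice regular function $\mathbb H\to\mathbb H$ and an anti-regular function $\mathbb H\to\mathbb H$ if and only if $M_{p,r}=f(p)$ for all $p\in\mathbb H$ and all $r>0$. -/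

import Mathlib

open MeasureTheory
open scoped Quaternion

noncomputable section

namespace SliceMean

/-- The sphere `𝕊` of imaginary units of the quaternions. -/
def imagUnits : Set ℍ[ℝ] := {q | q ^ 2 = -1}

/-- The involution `J ↦ -J` of the sphere of imaginary units. -/
def negUnit (J : imagUnits) : imagUnits :=
  ⟨-(J : ℍ[ℝ]), by
    have h : (J : ℍ[ℝ]) ^ 2 = -1 := J.2
    simpa [imagUnits] using h⟩

/-- The complexification `ℍ ⊗ ℂ = {p + q ι | p, q ∈ ℍ}`; the pair `(p, q)` stands for `p + q ι`. -/
abbrev QuatC : Type := ℍ[ℝ] × ℍ[ℝ]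

/-- Complex conjugation `p + q ι ↦ p - q ι`. -/
def conjC (w : QuatC) : QuatC := (w.1, -w.2)

/-- Multiplication by the central element `ι`: `ι (p + q ι) = -q + p ι`. -/
def iotaMul (w : QuatC) : QuatC := (-w.2, w.1)

/-- Stem functions on `ℂ`: `F (conj z) = conj (F z)`. -/
def IsStem (F : ℂ → QuatC) : Prop :=
  ∀ z : ℂ, F ((starRingEnd ℂ) z) = conjC (F z)

/-- `f = 𝓘(F)`, that is `f (α + I β) = F₁ (α + i β) + I F₂ (α + i β)`. -/
def Induces (F : ℂ → QuatC) (f : ℍ[ℝ] → ℍ[ℝ]) : Prop :=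
  ∀ (α β : ℝ) (I : imagUnits),
    f ((α : ℍ[ℝ]) + (I : ℍ[ℝ]) * (β : ℍ[ℝ])) = (F ⟨α, β⟩).1 + (I : ℍ[ℝ]) * (F ⟨α, β⟩).2

/-- `∂F/∂z = (1/2) (∂F/∂α - ι ∂F/∂β)`. -/
def dz (F : ℂ → QuatC) (z : ℂ) : QuatC :=
  (1 / 2 : ℝ) • (fderiv ℝ F z 1 - iotaMul (fderiv ℝ F z Complex.I))

/-- `∂F/∂z̄ = (1/2) (∂F/∂α + ι ∂F/∂β)`. -/
def dzbar (F : ℂ → QuatC) (z : ℂ) : QuatC :=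
  (1 / 2 : ℝ) • (fderiv ℝ F z 1 + iotaMul (fderiv ℝ F z Complex.I))

/-- Holomorphic maps `ℂ → ℍ ⊗ ℂ`. -/
def IsHolomorphic (F : ℂ → QuatC) : Prop :=
  ContDiff ℝ 1 F ∧ ∀ z : ℂ, dzbar F z = 0

/-- Anti-holomorphic maps `ℂ → ℍ ⊗ ℂ`. -/
def IsAntiholomorphic (F : ℂ → QuatC) : Prop :=
  ContDiff ℝ 1 F ∧ ∀ z : ℂ, dz F z = 0

/-- (Left) slice regular functions on `ℍ`: those induced by a holomorphic stem function. -/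
def IsRegular (f : ℍ[ℝ] → ℍ[ℝ]) : Prop :=
  ∃ F : ℂ → QuatC, IsStem F ∧ IsHolomorphic F ∧ Induces F f

/-- (Left) anti-regular functions on `ℍ`: those induced by an anti-holomorphic stem function. -/
def IsAntiregular (f : ℍ[ℝ] → ℍ[ℝ]) : Prop :=
  ∃ F : ℂ → QuatC, IsStem F ∧ IsAntiholomorphic F ∧ Induces F f

/-- The mean `M_{p,r} = (1/2π) ∫_𝕊 ∫_0^{2π} (1 - I J) f (a + b J + r e^{Jθ}) dθ dμ(J)`
for `p = a + b I`. -/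
def mean [MeasurableSpace imagUnits] (μ : Measure imagUnits) (f : ℍ[ℝ] → ℍ[ℝ])
    (a b : ℝ) (I : imagUnits) (r : ℝ) : ℍ[ℝ] :=
  (1 / (2 * Real.pi)) • ∫ J : imagUnits, (∫ θ in (0 : ℝ)..(2 * Real.pi),
    (1 - (I : ℍ[ℝ]) * (J : ℍ[ℝ])) *
      f ((a : ℍ[ℝ]) + (b : ℍ[ℝ]) * (J : ℍ[ℝ]) +
        (r : ℍ[ℝ]) * NormedSpace.exp ((J : ℍ[ℝ]) * (θ : ℍ[ℝ])))) ∂μ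

end SliceMean

end

noncomputable section

namespace SliceMean

open Real Set ComplexConjugate

/-! Everything reduces to the mean value property of the stem function on circles in the plane. If
`F` induces `f`, expanding `(1 - IJ)(F₁ + J F₂)` with `J² = -1` gives `F₁ + I F₂` plus a term odd in
`J`, which the symmetry of `μ` kills; so the quaternionic mean is induced by the circle averages of
`F` (`mean_eq_circleAverage`). Holomorphic and anti-holomorphic maps have circle means, which gives
one direction.

Conversely, for any continuous `f` the mean is affine in `I` (`exists_mean_eq`). If it equals `f`,
then `f` is a slice function, and comparing `I` with `-I` shows that its stem function has circle
means. Such a function is smooth and harmonic, so each of its four complex coordinates is an entire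
function plus the conjugate of one; symmetrizing under conjugation makes both summands stem
functions. -/

/-- A function on the plane with the mean value property on all circles. -/
def HasCircleMeans {E : Type*} [NormedAddCommGroup E] [NormedSpace ℝ E] (u : ℂ → E) : Prop :=
  ∀ (z : ℂ) (r : ℝ), 0 < r → circleAverage u z r = u z

/-! ### Circle means imply smoothness and harmonicity. -/

/-- A smooth radial profile supported in the unit ball. -/
def radialBump (w : ℂ) : ℝ := smoothTransition (1 - ‖w‖ ^ 2)

lemma contDiff_radialBump {n : ℕ∞} : ContDiff ℝ n radialBump :=
  smoothTransition.contDiff.comp (contDiff_const.sub (contDiff_norm_sq ℝ))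

lemma radialBump_eq_zero {w : ℂ} (h : 1 ≤ ‖w‖) : radialBump w = 0 :=
  smoothTransition.zero_of_nonpos (by nlinarith)

lemma hasCompactSupport_radialBump : HasCompactSupport radialBump := by
  refine HasCompactSupport.intro (isCompact_closedBall (0 : ℂ) 1) fun w hw => ?_
  rw [Metric.mem_closedBall, dist_zero_right, not_le] at hw
  exact radialBump_eq_zero hw.le

lemma integral_radialBump_pos : 0 < ∫ w, radialBump w := by
  refine (contDiff_radialBump (n := 0)).continuous.integral_pos_of_hasCompactSupport_nonneg_nonzero
    hasCompactSupport_radialBump (fun w => smoothTransition.nonneg _) (x := 0) ?_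
  simp [radialBump]

/-- Shifting `θ` by `π` turns the subtraction into addition, and periodicity moves the interval to
the one used by polar coordinates. -/
lemma integral_circle_sub {u : ℂ → ℝ} (h : HasCircleMeans u) (z : ℂ) {r : ℝ} (hr : 0 < r) :
    ∫ θ in Ioo (-π) π, u (z - r * (Real.cos θ + Real.sin θ * Complex.I)) = 2 * π * u z := by
  have h1 := h z r hr
  rw [circleAverage_eq_integral_add π, smul_eq_mul, inv_mul_eq_iff_eq_mul₀ (by positivity)] at h1
  rw [← h1, ← integral_Ioc_eq_integral_Ioo, ← intervalIntegral.integral_of_le (by linarith [pi_pos])]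
  have h2 : Function.Periodic (fun θ => u (circleMap z r (θ + π))) (2 * π) := fun θ => by
    simp only [add_right_comm θ (2 * π) π, (periodic_circleMap z r) (θ + π)]
  have h3 := h2.intervalIntegral_add_eq (-π) 0
  rw [show -π + 2 * π = π by ring, zero_add] at h3
  rw [← h3]
  refine intervalIntegral.integral_congr fun θ _ => ?_
  simp only [circleMap, Complex.ofReal_add, add_mul, Complex.exp_add, Complex.exp_pi_mul_I]
  rw [Complex.exp_mul_I, Complex.ofReal_cos, Complex.ofReal_sin]
  congr 1
  ring

/-- The weight is constant on circles about the origin, so in polar coordinates the angular integral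
is a circle mean of `u`. -/
lemma integral_radialBump_mul_polar {u : ℂ → ℝ} (hu : Continuous u) (h : HasCircleMeans u)
    (z : ℂ) : ∫ w, radialBump w * u (z - w) =
      (∫ r in Ioi (0 : ℝ), r * smoothTransition (1 - r ^ 2)) * (2 * π * u z) := by
  rw [← Complex.integral_comp_polarCoord_symm]
  have hc : Continuous fun p : ℝ × ℝ => p.1 • (radialBump (Complex.polarCoord.symm p) *
      u (z - Complex.polarCoord.symm p)) := by
    simp only [Complex.polarCoord_symm_apply]
    have := (contDiff_radialBump (n := 0)).continuous
    fun_prop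
  have hi : IntegrableOn (fun p : ℝ × ℝ => p.1 • (radialBump (Complex.polarCoord.symm p) *
      u (z - Complex.polarCoord.symm p))) (Ioi 0 ×ˢ Ioo (-π) π) := by
    refine IntegrableOn.of_forall_sdiff_eq_zero (s := Icc 0 1 ×ˢ Icc (-π) π)
      (hc.continuousOn.integrableOn_compact (isCompact_Icc.prod isCompact_Icc))
      (measurableSet_Ioi.prod measurableSet_Ioo) ?_
    rintro ⟨r, θ⟩ ⟨⟨h1, h2⟩, h3⟩
    simp only [mem_prod, mem_Ioi, mem_Ioo, mem_Icc, not_and] at h1 h2 h3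
    have hr : 1 ≤ r := by
      by_contra hr
      exact h3 ⟨h1.le, (not_le.1 hr).le⟩ h2.1.le h2.2.le
    rw [radialBump_eq_zero, zero_mul, smul_zero]
    rw [Complex.norm_polarCoord_symm]
    exact hr.trans (le_abs_self _)
  rw [polarCoord_target, Measure.volume_eq_prod, setIntegral_prod _ hi, ← integral_mul_const]
  refine setIntegral_congr_fun measurableSet_Ioi fun r hr => ?_
  simp only [smul_eq_mul, ← mul_assoc]
  have h4 : ∀ θ : ℝ, radialBump (Complex.polarCoord.symm (r, θ)) = smoothTransition (1 - r ^ 2) :=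
    fun θ => by rw [radialBump, Complex.norm_polarCoord_symm, sq_abs]
  simp only [h4, integral_const_mul]
  rw [show r * smoothTransition (1 - r ^ 2) * 2 * π * u z
    = r * smoothTransition (1 - r ^ 2) * (2 * π * u z) by ring, ← integral_circle_sub h z hr]
  simp only [Complex.polarCoord_symm_apply]

/-- Convolution with a radial bump reproduces `u` up to a constant factor, and the convolution is
smooth. -/
lemma HasCircleMeans.contDiff {u : ℂ → ℝ} (h : HasCircleMeans u) (hu : Continuous u) {n : ℕ∞} :
    ContDiff ℝ n u := by
  -- The case `u = 1` identifies the radial constant with the integral of the bump.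
  have h1 := integral_radialBump_mul_polar (u := fun _ => 1) continuous_const
    (fun z r _ => circleAverage_const _ _ _) 0
  have h2 : u = fun z => (∫ w, radialBump w)⁻¹ *
      convolution radialBump u (ContinuousLinearMap.mul ℝ ℝ) volume z := by
    ext z
    rw [eq_inv_mul_iff_mul_eq₀ integral_radialBump_pos.ne', convolution_mul,
      integral_radialBump_mul_polar hu h]
    simp only [mul_one] at h1
    rw [h1]
    ring
  rw [h2]
  exact contDiff_const.mul (hasCompactSupport_radialBump.contDiff_convolution_left _
    contDiff_radialBump hu.locallyIntegrable)

lemma hasDerivAt_integral_of_continuous {Φ Φ' : ℝ → ℝ → ℝ} (hΦ : Continuous ↿Φ)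
    (hΦ' : Continuous ↿Φ') (hd : ∀ r θ, HasDerivAt (Φ · θ) (Φ' r θ) r) (a b r : ℝ) :
    HasDerivAt (fun r => ∫ θ in a..b, Φ r θ) (∫ θ in a..b, Φ' r θ) r := by
  obtain ⟨C, hC⟩ := ((isCompact_Icc (a := r - 1) (b := r + 1)).prod
    (isCompact_uIcc (a := a) (b := b))).exists_bound_of_continuousOn hΦ'.continuousOn
  have hs : ∀ r, Continuous (Φ r) := fun r => hΦ.comp (by fun_prop : Continuous fun θ => (r, θ))
  have hs' : ∀ r, Continuous (Φ' r) := fun r => hΦ'.comp (by fun_prop : Continuous fun θ => (r, θ))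
  exact (intervalIntegral.hasDerivAt_integral_of_dominated_loc_of_deriv_le (bound := fun _ => C)
    (Icc_mem_nhds (by linarith : r - 1 < r) (by linarith : r < r + 1))
    (.of_forall fun r => (hs r).aestronglyMeasurable) ((hs r).intervalIntegrable _ _)
    (hs' r).aestronglyMeasurable
    (.of_forall fun θ hθ x hx => hC (x, θ) ⟨hx, uIoc_subset_uIcc hθ⟩)
    intervalIntegrable_const (.of_forall fun θ _ x _ => hd x θ)).2

/-- The circle integral does not depend on `r`; its second derivative at `r = 0` is the integral of
`D²u(e, e)` over unit vectors `e`, which is `π` times the Laplacian. -/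
lemma HasCircleMeans.laplacian_eq_zero {u : ℂ → ℝ} (h : HasCircleMeans u)
    (hu : ContDiff ℝ 2 u) (z : ℂ) : Laplacian.laplacian u z = 0 := by
  set e : ℝ → ℂ := fun θ => Complex.exp (θ * Complex.I) with he
  have hec : Continuous e := by fun_prop
  have hline : ∀ (r θ : ℝ), HasDerivAt (fun r : ℝ => z + r * e θ) (e θ) r := fun r θ => by
    simpa using ((Complex.ofRealCLM.hasDerivAt (x := r)).mul_const (e θ)).const_add z
  have hu1 : ContDiff ℝ 1 (fderiv ℝ u) := hu.fderiv_right (by norm_num)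
  have hu2 : Continuous (fderiv ℝ (fderiv ℝ u)) := hu1.continuous_fderiv (by norm_num)
  have d1 := fun r => hasDerivAt_integral_of_continuous (Φ := fun r θ => u (z + r * e θ))
    (Φ' := fun r θ => fderiv ℝ u (z + r * e θ) (e θ))
    (by have := hu.continuous; simp only [Function.HasUncurry.uncurry, id]; fun_prop)
    (by have := hu1.continuous; simp only [Function.HasUncurry.uncurry, id]; fun_prop)
    (fun r θ => ((hu.differentiable (by norm_num) _).hasFDerivAt.comp_hasDerivAt r
      (hline r θ))) 0 (2 * π) r
  have d2 := hasDerivAt_integral_of_continuous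
    (Φ := fun r θ => fderiv ℝ u (z + r * e θ) (e θ))
    (Φ' := fun r θ => fderiv ℝ (fderiv ℝ u) (z + r * e θ) (e θ) (e θ))
    (by have := hu1.continuous; simp only [Function.HasUncurry.uncurry, id]; fun_prop)
    (by simp only [Function.HasUncurry.uncurry, id]; fun_prop)
    (fun r θ => (ContinuousLinearMap.apply ℝ ℝ (e θ)).hasFDerivAt.comp_hasDerivAt r
      ((hu1.differentiable (by norm_num) _).hasFDerivAt.comp_hasDerivAt r (hline r θ))) 0 (2 * π) 0
  have hconst : ∀ r : ℝ, ∫ θ in 0..2 * π, u (z + r * e θ) = 2 * π * u z := fun r => by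
    -- Differentiating at `r = 0` needs all real radii; the average is even in `r`.
    have h0 : circleAverage u z r = u z := by
      rcases eq_or_ne r 0 with rfl | hr
      · simp
      · rw [← circleAverage_abs_radius, h z |r| (abs_pos.2 hr)]
    rw [← h0, circleAverage_def, smul_eq_mul, mul_inv_cancel_left₀ (by positivity)]
    rfl
  have z1 : ∀ r : ℝ, ∫ θ in 0..2 * π, fderiv ℝ u (z + r * e θ) (e θ) = 0 := fun r => by
    have := d1 r
    simp only [hconst] at this
    exact this.unique (hasDerivAt_const _ _)
  simp only [z1] at d2
  have z2 := d2.unique (hasDerivAt_const _ _)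
  set B := fderiv ℝ (fderiv ℝ u) z with hB
  have hexp : ∀ θ : ℝ, B (e θ) (e θ) = Real.cos θ ^ 2 * B 1 1 +
      Real.sin θ * Real.cos θ * (B 1 Complex.I + B Complex.I 1) +
      Real.sin θ ^ 2 * B Complex.I Complex.I := fun θ => by
    have : e θ = Real.cos θ • (1 : ℂ) + Real.sin θ • Complex.I := by
      simp [he, Complex.exp_mul_I]
    rw [this]
    simp only [map_add, map_smul, add_apply, smul_apply, smul_eq_mul]
    ring
  simp only [Complex.ofReal_zero, zero_mul, add_zero, ← hB, hexp] at z2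
  rw [intervalIntegral.integral_add, intervalIntegral.integral_add] at z2
  · simp only [intervalIntegral.integral_mul_const, integral_cos_sq, integral_sin_sq,
      integral_sin_mul_cos₁] at z2
    simp only [Real.sin_two_pi, Real.cos_two_pi, Real.sin_zero, Real.cos_zero] at z2
    have : π * (B 1 1 + B Complex.I Complex.I) = 0 := by linear_combination z2
    rw [InnerProductSpace.laplacian_eq_iteratedFDeriv_complexPlane]
    simpa [iteratedFDeriv_two_apply, pi_ne_zero] using this
  all_goals exact Continuous.intervalIntegrable (by fun_prop) _ _

/-! ### Splitting into entire and conjugate-entire parts. -/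

lemma HasCircleMeans.exists_differentiable_re_eq {u : ℂ → ℝ} (h : HasCircleMeans u)
    (hu : Continuous u) : ∃ G : ℂ → ℂ, Differentiable ℂ G ∧ ∀ z, (G z).re = u z := by
  have h2 : ContDiff ℝ 2 u := h.contDiff hu
  obtain ⟨G, hG, hGu⟩ := InnerProductSpace.HarmonicOnNhd.exists_analyticOnNhd_univ_re_eq
    (f := u) fun x _ => ⟨h2.contDiffAt, .of_forall fun z => h.laplacian_eq_zero h2 z⟩
  exact ⟨G, fun z => (hG z (mem_univ z)).differentiableAt, fun z => congrFun hGu z⟩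

lemma HasCircleMeans.comp_clm {E F : Type*} [NormedAddCommGroup E] [NormedSpace ℝ E]
    [CompleteSpace E] [NormedAddCommGroup F] [NormedSpace ℝ F] [CompleteSpace F] {u : ℂ → E}
    (h : HasCircleMeans u) (hu : Continuous u) (l : E →L[ℝ] F) :
    HasCircleMeans (fun z => l (u z)) := fun z r hr => by
  have := l.circleAverage_comp_comm (hu.continuousOn.circleIntegrable' (c := z) (R := r))
  rw [h z r hr] at this
  exact this

/-- A continuous function with the mean value property is the sum of an entire function and the
conjugate of an entire function. -/
lemma HasCircleMeans.exists_add_conj {φ : ℂ → ℂ} (h : HasCircleMeans φ) (hφ : Continuous φ) :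
    ∃ g k : ℂ → ℂ, Differentiable ℂ g ∧ Differentiable ℂ k ∧ ∀ z, φ z = g z + conj (k z) := by
  obtain ⟨G, hG, hGu⟩ := (h.comp_clm hφ Complex.reCLM).exists_differentiable_re_eq (by fun_prop)
  obtain ⟨K, hK, hKu⟩ := (h.comp_clm hφ Complex.imCLM).exists_differentiable_re_eq (by fun_prop)
  -- From `φ = Re G + i Re K`, with each real part written as half the sum of the function and its
  -- conjugate.
  refine ⟨fun z => (G z + Complex.I * K z) / 2, fun z => (G z - Complex.I * K z) / 2,
    by fun_prop, by fun_prop, fun z => ?_⟩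
  have h1 := hGu z
  have h2 := hKu z
  simp only [Complex.reCLM_apply, Complex.imCLM_apply] at h1 h2
  simp only [map_div₀, map_ofNat]
  apply Complex.ext <;> simp [← h1, ← h2] <;> ring

/-- If moreover `φ (conj z) = conj (φ z)`, both entire functions may be chosen with this
symmetry. -/
lemma HasCircleMeans.exists_symm_add_conj {φ : ℂ → ℂ} (h : HasCircleMeans φ) (hφ : Continuous φ)
    (hs : ∀ z, φ (conj z) = conj (φ z)) :
    ∃ g k : ℂ → ℂ, Differentiable ℂ g ∧ Differentiable ℂ k ∧
      (∀ z, g (conj z) = conj (g z)) ∧ (∀ z, k (conj z) = conj (k z)) ∧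
      ∀ z, φ z = g z + conj (k z) := by
  obtain ⟨g, k, hg, hk, hgk⟩ := h.exists_add_conj hφ
  have hstar : ∀ {g : ℂ → ℂ}, Differentiable ℂ g → Differentiable ℂ fun z => conj (g (conj z)) :=
    fun {g} hg z => by
    simpa [Function.comp_def] using (hg (conj z)).conj_conj
  -- Average the decomposition of `φ z` with that of `conj (φ (conj z))`, which is again `φ z`.
  refine ⟨fun z => (g z + conj (g (conj z))) / 2, fun z => (k z + conj (k (conj z))) / 2,
    (hg.add (hstar hg)).div_const _, (hk.add (hstar hk)).div_const _, fun z => ?_, fun z => ?_,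
    fun z => ?_⟩
  · simp [add_comm, map_ofNat conj 2]
  · simp [add_comm, map_ofNat conj 2]
  · have h1 := hgk z
    have h2 := congrArg conj (hs z)
    rw [hgk (conj z)] at h2
    simp only [map_add, Complex.conj_conj, map_div₀, map_ofNat] at h2 ⊢
    linear_combination (1 / 2 : ℂ) * h1 - (1 / 2 : ℂ) * h2

/-! ### Reduction to complex-valued coordinates. -/

/-- The coordinates of `ℍ ⊗ ℂ` over `ℂ` with respect to the basis `1, i, j, k`. -/
def coord : QuatC ≃L[ℝ] (Fin 4 → ℂ) :=
  LinearEquiv.toContinuousLinearEquiv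
    { toFun := fun w => ![⟨w.1.re, w.2.re⟩, ⟨w.1.imI, w.2.imI⟩, ⟨w.1.imJ, w.2.imJ⟩,
        ⟨w.1.imK, w.2.imK⟩]
      invFun := fun x => (⟨(x 0).re, (x 1).re, (x 2).re, (x 3).re⟩,
        ⟨(x 0).im, (x 1).im, (x 2).im, (x 3).im⟩)
      map_add' := fun v w => by
        ext k
        fin_cases k <;> rfl
      map_smul' := fun c w => by
        ext k
        fin_cases k <;> apply Complex.ext <;> simp
      left_inv := fun w => rfl
      right_inv := fun x => by
        ext k
        fin_cases k <;> rfl }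

lemma coord_apply (w : QuatC) : coord w = ![⟨w.1.re, w.2.re⟩, ⟨w.1.imI, w.2.imI⟩,
    ⟨w.1.imJ, w.2.imJ⟩, ⟨w.1.imK, w.2.imK⟩] := rfl

lemma coord_iotaMul (w : QuatC) (k : Fin 4) : coord (iotaMul w) k = Complex.I * coord w k := by
  fin_cases k <;> apply Complex.ext <;> simp [coord_apply, iotaMul]

lemma coord_conjC (w : QuatC) (k : Fin 4) : coord (conjC w) k = conj (coord w k) := by
  fin_cases k <;> apply Complex.ext <;> simp [coord_apply, conjC]

lemma isStem_iff {F : ℂ → QuatC} :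
    IsStem F ↔ ∀ k z, coord (F (conj z)) k = conj (coord (F z) k) := by
  simp only [← coord_conjC]
  exact ⟨fun h k z => by rw [h z], fun h z => coord.injective (funext fun k => h k z)⟩

lemma contDiff_iff_coord {F : ℂ → QuatC} :
    ContDiff ℝ 1 F ↔ ∀ k, ContDiff ℝ 1 fun z => coord (F z) k := by
  rw [← coord.comp_contDiff_iff, contDiff_pi]
  rfl

lemma fderiv_coord {F : ℂ → QuatC} {z : ℂ} (hF : DifferentiableAt ℝ F z) (k : Fin 4) (v : ℂ) :
    fderiv ℝ (fun z => coord (F z) k) z v = coord (fderiv ℝ F z v) k := by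
  have h1 := ((ContinuousLinearMap.proj (R := ℝ) (φ := fun _ : Fin 4 => ℂ) k).comp
    coord.toContinuousLinearMap).hasFDerivAt.comp z hF.hasFDerivAt
  exact congrArg (· v) h1.fderiv

/-- Since `ι` acts on each coordinate as multiplication by `i`, `dzbar F = 0` is the Cauchy-Riemann
equation in each coordinate. -/
lemma isHolomorphic_iff {F : ℂ → QuatC} :
    IsHolomorphic F ↔ ∀ k, Differentiable ℂ fun z => coord (F z) k := by
  have key : ContDiff ℝ 1 F → ((∀ z, dzbar F z = 0) ↔
      ∀ k, Differentiable ℂ fun z => coord (F z) k) := fun hF => by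
    have hd := hF.differentiable (by norm_num)
    have hd' := fun k => (contDiff_iff_coord.1 hF k).differentiable (by norm_num)
    simp only [Differentiable]
    rw [forall_comm (α := Fin 4)]
    refine forall_congr' fun z => ?_
    rw [dzbar, smul_eq_zero_iff_right (by norm_num), ← coord.injective.eq_iff, funext_iff]
    refine forall_congr' fun k => ?_
    rw [differentiableAt_complex_iff_differentiableAt_real, and_iff_right (hd' k z),
      fderiv_coord (hd z), fderiv_coord (hd z), map_add, map_zero, Pi.add_apply, coord_iotaMul,
      smul_eq_mul]
    constructor <;> intro h
    · simp only [Pi.zero_apply] at h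
      linear_combination (-Complex.I) * h + coord (fderiv ℝ F z Complex.I) k * Complex.I_sq
    · simp only [Pi.zero_apply]
      linear_combination Complex.I * h + coord (fderiv ℝ F z 1) k * Complex.I_sq
  refine ⟨fun h => (key h.1).1 h.2, fun h => ?_⟩
  have hc : ContDiff ℝ 1 F :=
    contDiff_iff_coord.2 fun k => ((h k).contDiff (n := 1)).restrict_scalars ℝ
  exact ⟨hc, (key hc).2 h⟩

/-- Composing the second component with a sign exchanges holomorphic and anti-holomorphic maps. -/
lemma isAntiholomorphic_iff_conjC {F : ℂ → QuatC} :
    IsAntiholomorphic F ↔ IsHolomorphic fun z => conjC (F z) := by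
  let c : QuatC ≃L[ℝ] QuatC :=
    (ContinuousLinearEquiv.refl ℝ _).prodCongr (ContinuousLinearEquiv.neg ℝ)
  have hc : (fun z => conjC (F z)) = c ∘ F := rfl
  unfold IsAntiholomorphic IsHolomorphic
  rw [hc, c.comp_contDiff_iff]
  refine and_congr_right fun hF => forall_congr' fun z => ?_
  have hd := hF.differentiable (by norm_num) z
  have h1 : ∀ v, fderiv ℝ (c ∘ F) z v = conjC (fderiv ℝ F z v) := fun v =>
    congrArg (· v) (c.hasFDerivAt.comp z hd.hasFDerivAt).fderiv
  rw [dz, dzbar, h1, h1, smul_eq_zero_iff_right (by norm_num),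
    smul_eq_zero_iff_right (by norm_num)]
  simp only [conjC, iotaMul, Prod.ext_iff, Prod.fst_add, Prod.snd_add, Prod.fst_sub, Prod.snd_sub,
    Prod.fst_zero, Prod.snd_zero, sub_neg_eq_add, neg_neg]
  refine and_congr_right fun _ => ?_
  rw [← neg_eq_zero, neg_sub, sub_eq_neg_add]

lemma isAntiholomorphic_iff {F : ℂ → QuatC} :
    IsAntiholomorphic F ↔ ∀ k, Differentiable ℂ fun z => conj (coord (F z) k) := by
  simp only [isAntiholomorphic_iff_conjC, isHolomorphic_iff, coord_conjC]

lemma hasCircleMeans_of_differentiable {φ : ℂ → ℂ} (h : Differentiable ℂ φ) : HasCircleMeans φ :=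
  fun _ _ _ => h.diffContOnCl.circleAverage

lemma hasCircleMeans_iff_coord {F : ℂ → QuatC} (hF : Continuous F) :
    HasCircleMeans F ↔ ∀ k, HasCircleMeans fun z => coord (F z) k := by
  let l : Fin 4 → QuatC →L[ℝ] ℂ := fun k =>
    (ContinuousLinearMap.proj (R := ℝ) (φ := fun _ : Fin 4 => ℂ) k).comp
      coord.toContinuousLinearMap
  refine ⟨fun h k => h.comp_clm hF (l k), fun h z r hr => coord.injective (funext fun k => ?_)⟩
  refine Eq.trans ?_ (h k z r hr)
  exact ((l k).circleAverage_comp_comm (hF.continuousOn.circleIntegrable' (c := z) (R := r))).symm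

lemma IsHolomorphic.hasCircleMeans {F : ℂ → QuatC} (h : IsHolomorphic F) : HasCircleMeans F :=
  (hasCircleMeans_iff_coord h.1.continuous).2 fun k =>
    hasCircleMeans_of_differentiable (isHolomorphic_iff.1 h k)

lemma IsAntiholomorphic.hasCircleMeans {F : ℂ → QuatC} (h : IsAntiholomorphic F) :
    HasCircleMeans F := by
  refine (hasCircleMeans_iff_coord h.1.continuous).2 fun k => ?_
  have h1 := isAntiholomorphic_iff.1 h k
  have h2 := (hasCircleMeans_of_differentiable h1).comp_clm h1.continuous
    Complex.conjCLE.toContinuousLinearMap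
  simpa using h2

lemma HasCircleMeans.add {E : Type*} [NormedAddCommGroup E] [NormedSpace ℝ E] {F G : ℂ → E}
    (hF : HasCircleMeans F) (hG : HasCircleMeans G) (cF : Continuous F) (cG : Continuous G) :
    HasCircleMeans (F + G) := fun z r hr => by
  rw [circleAverage_add cF.continuousOn.circleIntegrable' cG.continuousOn.circleIntegrable',
    hF z r hr, hG z r hr, Pi.add_apply]

/-- A continuous stem function with the mean value property is the sum of a holomorphic and an
anti-holomorphic stem function. -/
lemma HasCircleMeans.exists_holomorphic_add_antiholomorphic {F : ℂ → QuatC}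
    (h : HasCircleMeans F) (hF : Continuous F) (hs : IsStem F) :
    ∃ G H : ℂ → QuatC, IsStem G ∧ IsHolomorphic G ∧ IsStem H ∧ IsAntiholomorphic H ∧
      ∀ z, F z = G z + H z := by
  have hc : ∀ k, Continuous fun z => coord (F z) k := fun k =>
    (continuous_apply k).comp (coord.continuous.comp hF)
  choose g m hg hm hgs hms hgm using fun k =>
    ((hasCircleMeans_iff_coord hF).1 h k).exists_symm_add_conj (hc k) (isStem_iff.1 hs k)
  refine ⟨fun z => coord.symm fun k => g k z, fun z => coord.symm fun k => conj (m k z),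
    isStem_iff.2 ?_, isHolomorphic_iff.2 ?_, isStem_iff.2 ?_, isAntiholomorphic_iff.2 ?_,
    fun z => ?_⟩
  · simpa using hgs
  · simpa using hg
  · intro k z
    simp only [ContinuousLinearEquiv.apply_symm_apply, hms]
  · simpa using hm
  · rw [← map_add, ContinuousLinearEquiv.eq_symm_apply]
    exact funext fun k => hgm k z

/-! ### Imaginary units and slices. -/

lemma imagUnits_mul_self (J : imagUnits) : (J : ℍ[ℝ]) * J = -1 := by
  rw [← sq]
  exact J.2

@[simp] lemma coe_negUnit (J : imagUnits) : (negUnit J : ℍ[ℝ]) = -J := rfl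

lemma norm_imagUnits (J : imagUnits) : ‖(J : ℍ[ℝ])‖ = 1 := by
  have h : ‖(J : ℍ[ℝ])‖ ^ 2 = 1 := by
    rw [sq, ← norm_mul, imagUnits_mul_self, norm_neg, norm_one]
  exact (pow_eq_one_iff_of_nonneg (norm_nonneg _) two_ne_zero).1 h

instance : CompactSpace imagUnits := by
  refine isCompact_iff_compactSpace.1 (Metric.isCompact_of_isClosed_isBounded ?_ ?_)
  · exact isClosed_eq (continuous_id.pow 2) continuous_const
  · exact (Metric.isBounded_closedBall (x := (0 : ℍ[ℝ])) (r := 1)).subset fun q hq => by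
      simpa using (norm_imagUnits ⟨q, hq⟩).le

/-- The quaternion unit `i`. -/
def unitI : imagUnits := ⟨(⟨0, 1, 0, 0⟩ : ℍ[ℝ]), by
  refine (sq _).trans ((QuaternionAlgebra.mk_mul_mk ..).trans ?_)
  ext <;> simp⟩

lemma continuous_negUnit : Continuous negUnit :=
  continuous_subtype_val.neg.subtype_mk _

/-- The slice of an imaginary unit `J`: the embedding `α + i β ↦ α + J β` of `ℂ` into `ℍ`. -/
def slice (J : imagUnits) : ℂ →ₐ[ℝ] ℍ[ℝ] := Complex.lift ⟨J, imagUnits_mul_self J⟩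

lemma slice_apply (J : imagUnits) (z : ℂ) :
    slice J z = (z.re : ℍ[ℝ]) + (J : ℍ[ℝ]) * (z.im : ℍ[ℝ]) := by
  rw [Quaternion.mul_coe_eq_smul]
  exact Complex.liftAux_apply _ (imagUnits_mul_self J) _

lemma continuous_slice (J : imagUnits) : Continuous (slice J) :=
  (slice J).toLinearMap.continuous_of_finiteDimensional

/-- The slice embedding is a continuous algebra homomorphism, so it commutes with `exp` and carries
plane circles to the circles in the mean. -/
lemma circle_imagUnits (a b r θ : ℝ) (J : imagUnits) :
    (a : ℍ[ℝ]) + (b : ℍ[ℝ]) * (J : ℍ[ℝ]) + (r : ℍ[ℝ]) * NormedSpace.exp ((J : ℍ[ℝ]) * (θ : ℍ[ℝ]))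
      = ((circleMap ⟨a, b⟩ r θ).re : ℍ[ℝ]) + (J : ℍ[ℝ]) * ((circleMap ⟨a, b⟩ r θ).im : ℍ[ℝ]) := by
  have h1 : slice J (θ * Complex.I) = J * (θ : ℍ[ℝ]) := by simp [slice_apply]
  have h2 : slice J (r : ℂ) = r := by simp
  let +nondep : NormedAlgebra ℚ ℍ[ℝ] := .restrictScalars ℚ ℝ ℍ[ℝ]
  rw [← slice_apply, circleMap, map_add, map_mul, Complex.exp_eq_exp_ℂ,
    NormedSpace.map_exp (slice J) (continuous_slice J), h1, h2, slice_apply,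
    Quaternion.coe_commutes b]

/-! ### The quaternionic mean. -/

section Mean

variable [MeasurableSpace imagUnits] [BorelSpace imagUnits] {μ : Measure imagUnits}

lemma integral_eq_zero_of_odd (hμ : μ.map negUnit = μ) {g : imagUnits → ℍ[ℝ]} (hg : Continuous g)
    (hodd : ∀ J, g (negUnit J) = -g J) : ∫ J, g J ∂μ = 0 := by
  have h := integral_map (μ := μ) continuous_negUnit.aemeasurable
    (f := g) hg.aestronglyMeasurable
  rw [hμ] at h
  simp only [hodd, integral_neg] at h
  have h2 : (2 : ℝ) • ∫ J, g J ∂μ = 0 := by rw [two_smul, ← eq_neg_iff_add_eq_zero, ← h]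
  exact (smul_eq_zero_iff_right two_ne_zero).1 h2

variable [IsProbabilityMeasure μ]

lemma integrable_of_continuous {g : imagUnits → ℍ[ℝ]} (hg : Continuous g) : Integrable g μ :=
  hg.integrable_of_hasCompactSupport (.of_compactSpace g)

/-- For a slice function the quaternionic mean is the circle average of its stem function. -/
lemma mean_eq_circleAverage (hμ : μ.map negUnit = μ) {F : ℂ → QuatC} {f : ℍ[ℝ] → ℍ[ℝ]}
    (hF : Continuous F) (h : Induces F f) (a b : ℝ) (I : imagUnits) (r : ℝ) :
    mean μ f a b I r = (circleAverage F ⟨a, b⟩ r).1 + I * (circleAverage F ⟨a, b⟩ r).2 := by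
  have hc : Continuous fun θ => F (circleMap ⟨a, b⟩ r θ) := by fun_prop
  have i1 := hc.fst.intervalIntegrable (μ := volume) 0 (2 * π)
  have i2 := hc.snd.intervalIntegrable (μ := volume) 0 (2 * π)
  set A := ∫ θ in 0..2 * π, (F (circleMap ⟨a, b⟩ r θ)).1 with hA
  set B := ∫ θ in 0..2 * π, (F (circleMap ⟨a, b⟩ r θ)).2 with hB
  have hAB : circleAverage F ⟨a, b⟩ r = (2 * π)⁻¹ • (A, B) := by
    rw [circleAverage_def]
    congr 1
    have i := hc.intervalIntegrable (μ := volume) 0 (2 * π)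
    exact Prod.ext ((ContinuousLinearMap.fst ℝ ℍ[ℝ] ℍ[ℝ]).intervalIntegral_comp_comm i).symm
      ((ContinuousLinearMap.snd ℝ ℍ[ℝ] ℍ[ℝ]).intervalIntegral_comp_comm i).symm
  have hmul : ∀ (c : ℍ[ℝ]) (φ : ℝ → ℍ[ℝ]), IntervalIntegrable φ volume 0 (2 * π) →
      ∫ θ in 0..2 * π, c * φ θ = c * ∫ θ in 0..2 * π, φ θ := fun c φ hφ =>
    (ContinuousLinearMap.mul ℝ ℍ[ℝ] c).intervalIntegral_comp_comm hφ
  -- The second bracket is odd in `J`, so it integrates to zero against `μ`.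
  have inner : ∀ J : imagUnits, (∫ θ in (0 : ℝ)..(2 * π), (1 - (I : ℍ[ℝ]) * (J : ℍ[ℝ])) *
      f ((a : ℍ[ℝ]) + (b : ℍ[ℝ]) * (J : ℍ[ℝ]) +
        (r : ℍ[ℝ]) * NormedSpace.exp ((J : ℍ[ℝ]) * (θ : ℍ[ℝ])))) =
      (A + I * B) + ((J : ℍ[ℝ]) * B - I * J * A) := fun J => by
    simp only [circle_imagUnits, h _ _ J, Complex.eta]
    have i3 : IntervalIntegrable (fun θ => (J : ℍ[ℝ]) * (F (circleMap ⟨a, b⟩ r θ)).2) volume 0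
      (2 * π) := (continuous_const.mul hc.snd).intervalIntegrable _ _
    rw [hmul _ _ (i1.add i3), intervalIntegral.integral_add i1 i3, hmul _ _ i2, ← hA, ← hB,
      sub_mul, mul_add, mul_add, one_mul, one_mul, mul_assoc (I : ℍ[ℝ]) J (J * B),
      ← mul_assoc (J : ℍ[ℝ]) J B, imagUnits_mul_self, neg_mul, one_mul, mul_neg]
    abel
  have hodd : Continuous fun J : imagUnits => (J : ℍ[ℝ]) * B - I * J * A := by fun_prop
  rw [mean]
  simp only [inner]
  rw [integral_add (integrable_const _) (integrable_of_continuous hodd),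
    integral_eq_zero_of_odd hμ hodd (fun J => by simp; abel), hAB]
  simp [smul_add]

/-- The mean is affine in `I`. -/
lemma exists_mean_eq {f : ℍ[ℝ] → ℍ[ℝ]} (hf : Continuous f) (a b r : ℝ) :
    ∃ X Y : ℍ[ℝ], ∀ I : imagUnits, mean μ f a b I r = X + I * Y := by
  set φ : imagUnits → ℝ → ℍ[ℝ] := fun J θ => f ((a : ℍ[ℝ]) + (b : ℍ[ℝ]) * (J : ℍ[ℝ]) +
        (r : ℍ[ℝ]) * NormedSpace.exp ((J : ℍ[ℝ]) * (θ : ℍ[ℝ]))) with hφ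
  have hφc : Continuous ↿φ := by
    simp only [hφ, circle_imagUnits, Function.HasUncurry.uncurry, id]
    have := Quaternion.continuous_coe
    fun_prop
  have hψ : Continuous fun J => ∫ θ in (0 : ℝ)..(2 * π), φ J θ :=
    intervalIntegral.continuous_parametric_intervalIntegral_of_continuous' hφc _ _
  set ψ := fun J => ∫ θ in (0 : ℝ)..(2 * π), φ J θ
  refine ⟨(1 / (2 * π)) • ∫ J, ψ J ∂μ, -((1 / (2 * π)) • ∫ J : imagUnits, J * ψ J ∂μ),
    fun I => ?_⟩
  have inner : ∀ J : imagUnits, ∫ θ in (0 : ℝ)..(2 * π), (1 - (I : ℍ[ℝ]) * (J : ℍ[ℝ])) * φ J θ =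
      ψ J - I * (J * ψ J) := fun J => by
    rw [← mul_assoc, ← one_sub_mul]
    exact (ContinuousLinearMap.mul ℝ ℍ[ℝ] (1 - (I : ℍ[ℝ]) * J)).intervalIntegral_comp_comm
      ((hφc.comp (by fun_prop : Continuous fun θ : ℝ => (J, θ))).intervalIntegrable _ _)
  have hJψ : Continuous fun J : imagUnits => (J : ℍ[ℝ]) * ψ J := by fun_prop
  have hlin : ∫ J : imagUnits, (I : ℍ[ℝ]) * (J * ψ J) ∂μ = I * ∫ J : imagUnits, J * ψ J ∂μ :=
    (ContinuousLinearMap.mul ℝ ℍ[ℝ] (I : ℍ[ℝ])).integral_comp_comm (integrable_of_continuous hJψ)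
  rw [mean]
  change (1 / (2 * π)) • ∫ J, (∫ θ in (0 : ℝ)..(2 * π), (1 - (I : ℍ[ℝ]) * (J : ℍ[ℝ])) * φ J θ) ∂μ
    = _
  simp only [inner]
  rw [integral_sub (integrable_of_continuous hψ) (integrable_of_continuous (by fun_prop)), hlin,
    smul_sub, mul_neg, mul_smul_comm, sub_eq_add_neg]

end Mean

/-! ### Slice functions and their stem functions. -/

/-- The stem function recovered from the values of a slice function on one slice. -/
def stemOf (f : ℍ[ℝ] → ℍ[ℝ]) (z : ℂ) : QuatC :=
  ((1 / 2 : ℝ) • (f (z.re + unitI * z.im) + f (z.re - unitI * z.im)),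
    (1 / 2 : ℝ) • (-(unitI : ℍ[ℝ]) * (f (z.re + unitI * z.im) - f (z.re - unitI * z.im))))

lemma isStem_stemOf (f : ℍ[ℝ] → ℍ[ℝ]) : IsStem (stemOf f) := fun z => by
  simp only [stemOf, conjC, Complex.conj_re, Complex.conj_im, Quaternion.coe_neg, mul_neg,
    sub_neg_eq_add, ← sub_eq_add_neg]
  refine Prod.ext (by simp only [add_comm]) ?_
  simp only [← smul_neg, ← mul_neg, neg_sub]

lemma continuous_stemOf {f : ℍ[ℝ] → ℍ[ℝ]} (hf : Continuous f) : Continuous (stemOf f) := by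
  have := Quaternion.continuous_coe
  unfold stemOf
  fun_prop

lemma induces_stemOf {f : ℍ[ℝ] → ℍ[ℝ]} (h : ∀ a b : ℝ, ∃ X Y : ℍ[ℝ], ∀ I : imagUnits,
    f ((a : ℍ[ℝ]) + I * (b : ℍ[ℝ])) = X + I * Y) : Induces (stemOf f) f := fun a b I => by
  obtain ⟨X, Y, hXY⟩ := h a b
  have h1 := hXY unitI
  have h2 := hXY (negUnit unitI)
  simp only [coe_negUnit, neg_mul, ← sub_eq_add_neg] at h2
  have e1 : (1 / 2 : ℝ) • (X + unitI * Y + (X - unitI * Y)) = X := by module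
  have e2 : (1 / 2 : ℝ) • (-(unitI : ℍ[ℝ]) * (X + unitI * Y - (X - unitI * Y))) = Y := by
    rw [show X + unitI * Y - (X - unitI * Y) = unitI * (Y + Y) by rw [mul_add]; abel, ← mul_assoc,
      neg_mul, imagUnits_mul_self, neg_neg, one_mul]
    module
  rw [hXY I, stemOf]
  simp only [h1, h2, e1, e2]

lemma re_imagUnits (J : imagUnits) : (J : ℍ[ℝ]).re = 0 := by
  rw [← Quaternion.sq_eq_neg_normSq, Quaternion.normSq_eq_norm_mul_self, norm_imagUnits, sq,
    imagUnits_mul_self]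
  simp

lemma im_imagUnits (J : imagUnits) : (J : ℍ[ℝ]).im = J := by
  have h := Quaternion.re_add_im (J : ℍ[ℝ])
  rwa [re_imagUnits, Quaternion.coe_zero, zero_add] at h

/-- Every stem function induces a function on the quaternions. -/
lemma IsStem.exists_induces {F : ℂ → QuatC} (hF : IsStem F) : ∃ f, Induces F f := by
  -- Represent `q` with `β = ‖q.im‖ ≥ 0`; the stem symmetry covers `β < 0` and makes the second
  -- component vanish at real points, where the unit is undetermined.
  refine ⟨fun q => (F ⟨q.re, ‖q.im‖⟩).1 + ‖q.im‖⁻¹ • q.im * (F ⟨q.re, ‖q.im‖⟩).2,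
    fun α β I => ?_⟩
  have hre : ((α : ℍ[ℝ]) + I * (β : ℍ[ℝ])).re = α := by
    simp [Quaternion.mul_coe_eq_smul, re_imagUnits]
  have him : ((α : ℍ[ℝ]) + I * (β : ℍ[ℝ])).im = β • (I : ℍ[ℝ]) := by
    simp [Quaternion.mul_coe_eq_smul, im_imagUnits]
  have hnorm : ‖β • (I : ℍ[ℝ])‖ = |β| := by
    rw [norm_smul, norm_imagUnits, mul_one, Real.norm_eq_abs]
  have hconj : F ⟨α, -β⟩ = conjC (F ⟨α, β⟩) := hF ⟨α, β⟩
  simp only [hre, him, hnorm]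
  rcases lt_trichotomy β 0 with hβ | rfl | hβ
  · rw [abs_of_neg hβ, hconj, smul_smul, inv_neg, neg_mul, inv_mul_cancel₀ hβ.ne]
    simp [conjC]
  · rw [neg_zero] at hconj
    have h0 : (F ⟨α, 0⟩).2 = 0 := by
      have h1 : (F ⟨α, 0⟩).2 = -(F ⟨α, 0⟩).2 := congrArg Prod.snd hconj
      have h2 : (2 : ℝ) • (F ⟨α, 0⟩).2 = 0 := by
        rw [two_smul, ← eq_neg_iff_add_eq_zero, ← h1]
      exact (smul_eq_zero_iff_right two_ne_zero).1 h2
    simp [h0]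
  · rw [abs_of_pos hβ, smul_smul, inv_mul_cancel₀ hβ.ne', one_smul]

lemma eq_of_forall_add_mul_eq {X Y X' Y' : ℍ[ℝ]}
    (h : ∀ I : imagUnits, X + I * Y = X' + I * Y') : X = X' ∧ Y = Y' := by
  have h1 := h unitI
  have h2 := h (negUnit unitI)
  simp only [coe_negUnit, neg_mul] at h2
  have hX : X = X' := by
    have e : (1 / 2 : ℝ) • ((X + unitI * Y) + (X + -(unitI * Y))) =
      (1 / 2 : ℝ) • ((X' + unitI * Y') + (X' + -(unitI * Y'))) := by rw [h1, h2]
    convert e using 1 <;> module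
  refine ⟨hX, ?_⟩
  rw [hX, add_right_inj] at h1
  have h3 := congrArg (-(unitI : ℍ[ℝ]) * ·) h1
  simpa only [← mul_assoc, neg_mul, imagUnits_mul_self, neg_neg, one_mul] using h3

end SliceMean

end

theorem theorem4p2 [MeasurableSpace SliceMean.imagUnits] [BorelSpace SliceMean.imagUnits]
    (μ : Measure SliceMean.imagUnits) [IsProbabilityMeasure μ]
    (hμ : μ.map SliceMean.negUnit = μ)
    (f : ℍ[ℝ] → ℍ[ℝ]) (hf : Continuous f) :
    (∃ g h : ℍ[ℝ] → ℍ[ℝ],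
        SliceMean.IsRegular g ∧ SliceMean.IsAntiregular h ∧ ∀ q, f q = g q + h q) ↔
      ∀ p : ℍ[ℝ], ∀ r : ℝ, 0 < r → ∀ (a b : ℝ) (I : SliceMean.imagUnits),
        p = (a : ℍ[ℝ]) + (b : ℍ[ℝ]) * (I : ℍ[ℝ]) → SliceMean.mean μ f a b I r = f p := by
  open SliceMean Real in
  constructor
  · rintro ⟨g, h, ⟨G, -, hG, hGg⟩, ⟨H, -, hH, hHh⟩, hfgh⟩ p r hr a b I rfl
    have hF : Induces (G + H) f := fun α β J => by
      rw [hfgh, hGg, hHh, Pi.add_apply, Prod.fst_add, Prod.snd_add, mul_add]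
      abel
    rw [mean_eq_circleAverage hμ (hG.1.continuous.add hH.1.continuous) hF,
      hG.hasCircleMeans.add hH.hasCircleMeans hG.1.continuous hH.1.continuous _ r hr, ← hF,
      Quaternion.coe_commutes]
  · intro hmean
    have hval : ∀ (a b r : ℝ), 0 < r → ∀ I : imagUnits,
        f ((a : ℍ[ℝ]) + I * (b : ℍ[ℝ])) = mean μ f a b I r := fun a b r hr I => by
      rw [hmean _ r hr a b I rfl, Quaternion.coe_commutes]
    have hind : Induces (stemOf f) f := induces_stemOf fun a b => by
      -- A single radius is enough for the slice form.
      obtain ⟨X, Y, hXY⟩ := exists_mean_eq (μ := μ) hf a b 1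
      exact ⟨X, Y, fun I => by rw [hval a b 1 one_pos, hXY]⟩
    have hcm : HasCircleMeans (stemOf f) := fun z r hr => by
      have := eq_of_forall_add_mul_eq fun I => show (circleAverage (stemOf f) z r).1 +
          I * (circleAverage (stemOf f) z r).2 = (stemOf f z).1 + I * (stemOf f z).2 by
        rw [← hind z.re z.im I, hval _ _ r hr I,
          mean_eq_circleAverage hμ (continuous_stemOf hf) hind]
      exact Prod.ext this.1 this.2
    obtain ⟨G, H, hGs, hG, hHs, hH, hGH⟩ :=
      hcm.exists_holomorphic_add_antiholomorphic (continuous_stemOf hf) (isStem_stemOf f)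
    obtain ⟨g, hg⟩ := hGs.exists_induces
    -- Since `stemOf f = G + H` induces `f`, the difference `f - g` is induced by `H`.
    refine ⟨g, fun q => f q - g q, ⟨G, hGs, hG, hg⟩, ⟨H, hHs, hH, fun α β I => ?_⟩,
      fun q => (add_sub_cancel _ _).symm⟩
    simp only
    rw [hind, hg, hGH, Prod.fst_add, Prod.snd_add, mul_add]
    abel
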